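/- **Setting.** A polygonal element is a nonempty, bounded, connected open set $P\subset\mathbb{R}^2$ whose boundary is a simple closed polygonal curve with pairwise distinct vertices $x_1,\dots,x_N$ ($N\ge 3$; flat angles at vertices are allowed) and straight edges $E\subset\partial P$ joining consecutive vertices. Let $h_P$ be its diameter and $|P|$ its area. For $\rho>0$, $P$ is called $\rho$-regular if * (M1) $P$ is star-shaped with respect to (every point of) a ball contained in $P$ of radius greater than $\rho h_P$; * (M2) every edge of $P$ has length at least $\rho h_P$. Let $\mathbb{P}_1$ denote the polynomials of degree at most one. The local virtual element space is $$V_h(P)=\{v\in H^1(P)\cap C(\overline P): v|_E\in\mathbb{P}_1(E)\ \text{for every edge } E\subset\partial P,\ \Delta v=0 \text{ in } P\}.$$ For $v\in V_h(P)$, $\widetilde\Pi^P v\in\mathbb{P}_1(P)$ is the unique linear polynomial with $$|P|\sum_{i=1}^{N}\big(v(x_i)-(\widetilde\Pi^P v)(x_i)\big)\,q(x_i)=0\qquad\text{for all } q\in\mathbb{P}_1(P).$$ Let $\Omega\subset\mathbb{R}^2$ be an open, bounded, polygonal set with Lipschitz boundary. A mesh $\mathcal{T}_h$ of $\Omega$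 is a finite set of polygonal elements whose closures cover $\overline\Omega$, such that the closures of two different elements intersect in a set of zero area and their boundaries intersect only in common vertices and shared edges. The global virtual element space is $$V_h=\{v\in H^1_0(\Omega): v|_P\in V_h(P)\ \text{for all } P\in\mathcal{T}_h\}.$$ Write $\|\cdot\|_{0,P}$ for the norm of $L^2(P)$ and $|v|_{1,P}=\|\nabla v\|_{0,P}$. **Lemma.** For every $\rho>0$ there is a constant $C>0$, depending only on $\rho$, such that 1. for every $\rho$-regular polygonal element $P$ and every $v_h\in V_h(P)$, $$\|v_h-\widetilde\Pi^P v_h\|_{0,P}\le C\,h_P\,|v_h|_{1,P};$$ 2. consequently, for every such $\Omega$, every mesh $\mathcal{T}_h$ of $\Omega$ (of whatever mesh size $h$) all of whose elements are $\rho$-regular, every $v_h\in V_h$ and every $P\in\mathcal{T}_h$, the same inequality holds with the same $C$. -/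

import Mathlib

open MeasureTheory Topology
open scoped ContDiff

/-- The Euclidean plane. -/
abbrev Plane : Type := EuclideanSpace ℝ (Fin 2)

namespace VEM

noncomputable section

/-! ### Sobolev spaces -/

/-- The norm `‖f‖_{0,D}` of `L²(D)`, for scalar or vector valued functions. -/
def l2Norm {F : Type*} [NormedAddCommGroup F] (D : Set Plane) (f : Plane → F) : ℝ :=
  Real.sqrt (∫ x in D, ‖f x‖ ^ 2)

/-- `φ ∈ C_c^∞(D)`. -/
def IsTestFunction (D : Set Plane) (φ : Plane → ℝ) : Prop :=
  ContDiff ℝ ∞ φ ∧ HasCompactSupport φ ∧ tsupport φ ⊆ D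

/-- `g ∈ L²(D)` is the weak gradient of `v` in `D`. -/
def IsWeakGrad (D : Set Plane) (v : Plane → ℝ) (g : Plane → Plane) : Prop :=
  MemLp g 2 (volume.restrict D) ∧
    ∀ φ : Plane → ℝ, IsTestFunction D φ → ∀ i : Fin 2,
      ∫ x in D, v x * fderiv ℝ φ x (EuclideanSpace.single i 1) = -∫ x in D, g x i * φ x

/-- `v ∈ H¹(D)`. -/
def MemH1 (D : Set Plane) (v : Plane → ℝ) : Prop :=
  MemLp v 2 (volume.restrict D) ∧ ∃ g, IsWeakGrad D v g

open Classical in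
/-- The weak gradient of `v ∈ H¹(D)`; it is unique up to a null set of `D`. -/
def weakGrad (D : Set Plane) (v : Plane → ℝ) : Plane → Plane :=
  if h : ∃ g, IsWeakGrad D v g then h.choose else 0

theorem isWeakGrad_weakGrad {D : Set Plane} {v : Plane → ℝ} (h : MemH1 D v) :
    IsWeakGrad D v (weakGrad D v) := by
  rw [weakGrad, dif_pos h.2]
  exact h.2.choose_spec

/-- The seminorm `|v|_{1,D}` of `H¹(D)`. -/
def h1Seminorm (D : Set Plane) (v : Plane → ℝ) : ℝ :=
  l2Norm D (weakGrad D v)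

/-- `v ∈ H¹₀(D)`, the closure of `C_c^∞(D)` in `H¹(D)`. -/
def MemH10 (D : Set Plane) (v : Plane → ℝ) : Prop :=
  MemH1 D v ∧ ∀ ε : ℝ, 0 < ε → ∃ φ : Plane → ℝ, IsTestFunction D φ ∧
    l2Norm D (fun x => v x - φ x) ≤ ε ∧
    l2Norm D (fun x => weakGrad D v x - gradient φ x) ≤ ε

/-! ### Polygonal elements -/

/-- An open polygon `P` whose boundary is a simple closed polygonal curve. The vertices are part of
the data, and an angle at a vertex may be flat. -/
structure PolygonalElement where
  /-- The number of vertices. -/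
  n : ℕ
  three_le : 3 ≤ n
  /-- The vertices `x_0, …, x_{n-1}` in cyclic order; the `i`-th edge joins `x_i` and `x_{i+1}`. -/
  poly : Polygon Plane n
  injective : Function.Injective poly.vertices
  edge_inter_next : ∀ i : Fin n,
    poly.edgeSet ℝ i ∩ poly.edgeSet ℝ (finRotate n i) = {poly.vertices (finRotate n i)}
  edge_disjoint : ∀ i j : Fin n, i ≠ j → j ≠ finRotate n i → i ≠ finRotate n j →
    Disjoint (poly.edgeSet ℝ i) (poly.edgeSet ℝ j)
  /-- The open region enclosed by the curve. -/
  carrier : Set Plane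
  isOpen : IsOpen carrier
  isConnected : IsConnected carrier
  isBounded : Bornology.IsBounded carrier
  frontier_eq : frontier carrier = poly.boundary ℝ

namespace PolygonalElement

variable (P : PolygonalElement)

/-- The `i`-th vertex. -/
def vertex (i : Fin P.n) : Plane := P.poly.vertices i

/-- The `i`-th edge, a closed segment. -/
def edge (i : Fin P.n) : Set Plane := P.poly.edgeSet ℝ i

/-- The length of the `i`-th edge. -/
def edgeLength (i : Fin P.n) : ℝ := dist (P.vertex i) (P.vertex (finRotate P.n i))

/-- The diameter `h_P`. -/
def diam : ℝ := Metric.diam P.carrier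

/-- The area `|P|`. -/
def area : ℝ := volume.real P.carrier

/-- Mesh regularity with constant `ρ`: `P` is star-shaped with respect to every point of a ball of
radius greater than `ρ h_P`, and every edge has length at least `ρ h_P`. -/
def IsRegular (ρ : ℝ) : Prop :=
  (∃ (c : Plane) (r : ℝ), ρ * P.diam < r ∧ Metric.ball c r ⊆ P.carrier ∧
    ∀ y ∈ Metric.ball c r, StarConvex ℝ y P.carrier) ∧
  ∀ i : Fin P.n, ρ * P.diam ≤ P.edgeLength i

/-- `v` belongs to the local virtual element space `V_h(P)`: it is in `H¹(P)`, continuous on the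
closure of `P`, a polynomial of degree at most one on each edge, and harmonic in `P`. -/
def MemVEM (v : Plane → ℝ) : Prop :=
  MemH1 P.carrier v ∧ ContinuousOn v (closure P.carrier) ∧
    (∀ i : Fin P.n, ∃ q : Plane →ᵃ[ℝ] ℝ, Set.EqOn v q (P.edge i)) ∧
    InnerProductSpace.HarmonicOnNhd v P.carrier

/-- The discrete inner product `|P| ∑ᵢ v(xᵢ) w(xᵢ)`. -/
def discreteInner (v w : Plane → ℝ) : ℝ :=
  P.area * ∑ i : Fin P.n, v (P.vertex i) * w (P.vertex i)

/-- `p` is a projection of `v` onto the polynomials of degree at most one, with respect to the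
discrete inner product. -/
def IsPiLS (v : Plane → ℝ) (p : Plane →ᵃ[ℝ] ℝ) : Prop :=
  ∀ q : Plane →ᵃ[ℝ] ℝ, P.discreteInner (fun x => v x - p x) q = 0

/-- An affine function that vanishes at the vertices vanishes identically. -/
theorem eq_zero_of_vertex (q : Plane →ᵃ[ℝ] ℝ) (hq : ∀ i, q (P.vertex i) = 0) : q = 0 := by
  have hedge : ∀ y ∈ frontier P.carrier, q y = 0 := by
    intro y hy
    rw [P.frontier_eq, Polygon.boundary, Set.mem_iUnion] at hy
    obtain ⟨i, t, -, rfl⟩ := hy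
    rw [AffineMap.apply_lineMap]
    have h1 : q (P.poly.vertices i) = 0 := hq i
    have h2 : q (P.poly.vertices (finRotate P.n i)) = 0 := hq _
    rw [h1, h2]
    simp
  obtain ⟨d, hd, hd0⟩ : ∃ d : Plane, q.linear d = 0 ∧ d ≠ 0 := by
    have : LinearMap.ker q.linear ≠ ⊥ :=
      LinearMap.ker_ne_bot_of_finrank_lt (by simp)
    obtain ⟨d, hd, hd0⟩ := Submodule.exists_mem_ne_zero_of_ne_bot this
    exact ⟨d, hd, hd0⟩
  have hin : ∀ x ∈ P.carrier, q x = 0 := by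
    intro x hx
    have hconst : ∀ t : ℝ, q (x + t • d) = q x := by
      intro t
      have : q ((t • d) +ᵥ x) = q.linear (t • d) +ᵥ q x := q.map_vadd x (t • d)
      simpa [hd, add_comm] using this
    set L : Set Plane := Set.range fun t : ℝ => x + t • d
    have hL : IsPreconnected L := isPreconnected_range (by fun_prop)
    have hout : (L \ P.carrier).Nonempty := by
      by_contra hne
      rw [Set.not_nonempty_iff_eq_empty, Set.sdiff_eq_empty] at hne
      obtain ⟨R, hR⟩ := (P.isBounded.subset hne).exists_norm_le
      have hdpos : 0 < ‖d‖ := norm_pos_iff.mpr hd0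
      have h := hR _ ⟨(R + ‖x‖ + 1) / ‖d‖, rfl⟩
      have hR0 : 0 ≤ R := (norm_nonneg _).trans h
      have h3 : ‖((R + ‖x‖ + 1) / ‖d‖) • d‖ = R + ‖x‖ + 1 := by
        rw [norm_smul, Real.norm_of_nonneg (by positivity)]
        field_simp
      have h4 : ‖((R + ‖x‖ + 1) / ‖d‖) • d‖ ≤
          ‖x + ((R + ‖x‖ + 1) / ‖d‖) • d‖ + ‖x‖ := by
        simpa using norm_sub_le (x + ((R + ‖x‖ + 1) / ‖d‖) • d) x
      simp only at h
      linarith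
    obtain ⟨_, ⟨t, rfl⟩, hy⟩ : (L ∩ frontier P.carrier).Nonempty := by
      by_contra hne
      rw [Set.not_nonempty_iff_eq_empty, Set.eq_empty_iff_forall_notMem] at hne
      have hcl : ∀ y ∈ L, y ∈ closure P.carrier → y ∈ P.carrier := by
        intro y hy hyc
        by_contra hyn
        exact hne y ⟨hy, hyc, by rwa [P.isOpen.interior_eq]⟩
      obtain ⟨z, hz, hzn⟩ := hout
      obtain ⟨w, -, hw1, hw2⟩ := hL P.carrier (closure P.carrier)ᶜ P.isOpen
        isClosed_closure.isOpen_compl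
        (fun y hy => (Classical.em (y ∈ closure P.carrier)).imp (hcl y hy) id)
        ⟨x, ⟨0, by simp⟩, hx⟩ ⟨z, hz, fun h => hzn (hcl z hz h)⟩
      exact hw2 (subset_closure hw1)
    rw [← hconst t]
    exact hedge _ hy
  obtain ⟨x, hx⟩ := P.isConnected.nonempty
  have hspan : affineSpan ℝ P.carrier = ⊤ :=
    P.isOpen.affineSpan_eq_top ⟨x, hx⟩
  apply AffineMap.ext_on (s := P.carrier) hspan
  intro y hy
  simpa using hin y hy

theorem area_pos : 0 < P.area :=
  ENNReal.toReal_pos (P.isOpen.measure_pos volume P.isConnected.nonempty).ne'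
    P.isBounded.measure_lt_top.ne

/-- The projection exists and is unique. -/
theorem existsUnique_isPiLS (v : Plane → ℝ) : ∃! p : Plane →ᵃ[ℝ] ℝ, P.IsPiLS v p := by
  have key : ∀ p : Plane →ᵃ[ℝ] ℝ, P.IsPiLS v p ↔
      ∀ q : Plane →ᵃ[ℝ] ℝ, ∑ i, (v (P.vertex i) - p (P.vertex i)) * q (P.vertex i) = 0 := by
    intro p
    simp only [IsPiLS, discreteInner, mul_eq_zero, P.area_pos.ne', false_or]
  let A : (Plane →ᵃ[ℝ] ℝ) →ₗ[ℝ] EuclideanSpace ℝ (Fin P.n) :=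
    { toFun := fun q => WithLp.toLp 2 fun i => q (P.vertex i)
      map_add' := fun _ _ => rfl
      map_smul' := fun _ _ => rfl }
  let V : EuclideanSpace ℝ (Fin P.n) := WithLp.toLp 2 fun i => v (P.vertex i)
  obtain ⟨p, hp⟩ := LinearMap.mem_range.mp ((LinearMap.range A).starProjection_apply_mem V)
  have hp' : P.IsPiLS v p := by
    rw [key]
    intro q
    have h := (LinearMap.range A).starProjection_inner_eq_zero V (A q) ⟨q, rfl⟩
    rw [← hp, PiLp.inner_apply] at h
    rw [← h]
    refine Finset.sum_congr rfl fun i _ => ?_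
    exact mul_comm _ _
  refine ⟨p, hp', fun p' h' => ?_⟩
  rw [key] at hp' h'
  have hz : ∑ i, ((p' - p) (P.vertex i)) ^ 2 = 0 := by
    have h1 := hp' (p' - p)
    have h2 := h' (p' - p)
    rw [← sub_eq_zero.mpr (h1.trans h2.symm), ← Finset.sum_sub_distrib]
    refine Finset.sum_congr rfl fun i _ => ?_
    simp
    ring
  rw [Finset.sum_eq_zero_iff_of_nonneg fun i _ => sq_nonneg _] at hz
  exact sub_eq_zero.mp <| P.eq_zero_of_vertex _ fun i =>
    pow_eq_zero_iff (two_ne_zero) |>.mp (hz i (Finset.mem_univ i))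

/-- The projection operator `Π̃^P` onto the polynomials of degree at most one. -/
def piLS (v : Plane → ℝ) : Plane →ᵃ[ℝ] ℝ := (P.existsUnique_isPiLS v).exists.choose

theorem isPiLS_piLS (v : Plane → ℝ) : P.IsPiLS v (P.piLS v) :=
  (P.existsUnique_isPiLS v).exists.choose_spec

end PolygonalElement

/-! ### Meshes -/

/-- An open, bounded, polygonal set with Lipschitz boundary: the boundary is a finite union of
segments, and near each boundary point, in suitable Cartesian coordinates, the set is the region
above the graph of a Lipschitz function. -/
structure IsPolygonalDomain (Ω : Set Plane) : Prop where
  isOpen : IsOpen Ω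
  isBounded : Bornology.IsBounded Ω
  polygonal : ∃ S : Finset (Plane × Plane), frontier Ω = ⋃ s ∈ S, segment ℝ s.1 s.2
  lipschitz : ∀ x ∈ frontier Ω, ∃ (Φ : Plane ≃ᵃⁱ[ℝ] Plane) (γ : ℝ → ℝ) (K : NNReal),
    LipschitzWith K γ ∧ ∀ᶠ y in 𝓝 x, y ∈ Ω ↔ γ (Φ y 0) < Φ y 1

/-- A mesh of `Ω`: finitely many nonoverlapping polygonal elements whose closures cover the closure
of `Ω`, such that the boundaries of two elements meet only in common vertices and shared edges. -/
structure Mesh (Ω : Set Plane) where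
  elements : Set PolygonalElement
  finite : elements.Finite
  cover : closure Ω = ⋃ P ∈ elements, closure P.carrier
  nonoverlapping : ∀ P ∈ elements, ∀ Q ∈ elements, P ≠ Q →
    volume (closure P.carrier ∩ closure Q.carrier) = 0
  conforming : ∀ P ∈ elements, ∀ Q ∈ elements, P ≠ Q →
    ∀ x ∈ frontier P.carrier ∩ frontier Q.carrier,
      (∃ i j, P.vertex i = x ∧ Q.vertex j = x) ∨ ∃ i j, P.edge i = Q.edge j ∧ x ∈ P.edge i

namespace Mesh

variable {Ω : Set Plane} (T : Mesh Ω)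

/-- Mesh regularity with constant `ρ`. -/
def IsRegular (ρ : ℝ) : Prop := ∀ P ∈ T.elements, P.IsRegular ρ

/-- `v` belongs to the global virtual element space `V_h`: it is in `H¹₀(Ω)`, and its restriction to
each element `P` is in `V_h(P)`. -/
def MemVEM (v : Plane → ℝ) : Prop :=
  MemH10 Ω v ∧ ∀ P ∈ T.elements, P.MemVEM v

end Mesh

end

end VEM

namespace VEM

/-! ### The weak maximum principle -/

/-! The residual `v - piLS v` is harmonic in `P` and affine on every edge, so the maximum principle
bounds it in `P` by its largest value `M` at the vertices. Its L² norm is then at most `M` times the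
square root of the area, hence at most `2 M h_P`. It remains to bound `M` by a multiple of
`|v|_{1,P}` depending only on `ρ`.

The constants are among the affine functions, so least-squares optimality (`sum_sq_sub_piLS_le`)
replaces the vertex residuals by the deviations of the vertex values from one constant. Telescoping
around the boundary then leaves two quantities to control: the number of vertices, and the increment
of `v` over a single edge.

Both are controlled on the triangles joining the edges to the center `c` of the ball.
Star-shapedness and the edge length bound give each triangle twice-area at least `(ρ h_P)²`
(`exists_center`). The halves of these triangles are disjoint subsets of `P`, so comparing areas
bounds the number of vertices (`card_le`). For one edge, pairs of edge points are joined by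
two-segment paths inside the triangle, and integrating over these paths bounds the increment by the
Dirichlet energy (`sq_sub_mul_cross_le`). A general trace inequality is not needed, because `v` is
affine on the edge. -/

theorem _root_.IsLocalMax.deriv_deriv_nonpos {h : ℝ → ℝ} {a : ℝ} (hm : IsLocalMax h a)
    (hc : ContinuousAt h a) : deriv (deriv h) a ≤ 0 := by
  by_contra! hpos
  have hmin := isLocalMin_of_deriv_deriv_pos hpos hm.deriv_eq_zero hc
  -- A positive second derivative would make `a` a local minimum as well, so `h` would be locally
  -- constant and its second derivative zero.
  have hconst : h =ᶠ[𝓝 a] fun _ => h a := by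
    filter_upwards [hm, hmin] with t h1 h2 using le_antisymm h1 h2
  rw [hconst.deriv.deriv_eq] at hpos
  simp at hpos

theorem iteratedFDeriv_two_le_of_isLocalMax {E : Type*} [NormedAddCommGroup E]
    [InnerProductSpace ℝ E] {f : E → ℝ} {x e : E} {ε : ℝ}
    (hf : ContDiffAt ℝ 2 f x) (he : ‖e‖ = 1)
    (hm : IsLocalMax (fun y => f y + ε * ‖y‖ ^ 2) x) :
    iteratedFDeriv ℝ 2 f x ![e, e] ≤ -(2 * ε) := by
  have hl : HasDerivAt (fun t : ℝ => x + t • e) e 0 := by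
    simpa using ((hasDerivAt_id (0 : ℝ)).smul_const e).const_add x
  have hcl : ContinuousAt (fun t : ℝ => x + t • e) 0 := hl.continuousAt
  have hx : x + (0 : ℝ) • e = x := by simp
  set h : ℝ → ℝ := fun t => f (x + t • e) + ε * ‖x + t • e‖ ^ 2 with hh
  have hmax : IsLocalMax h 0 := by
    have : Filter.Tendsto (fun t : ℝ => x + t • e) (𝓝 0) (𝓝 x) := by
      simpa [ContinuousAt] using hcl
    have h2 := this.eventually hm
    filter_upwards [h2] with t ht
    simpa [hh] using ht
  have hsq : ∀ t : ℝ, ‖x + t • e‖ ^ 2 = ‖x‖ ^ 2 + 2 * t * inner ℝ x e + t ^ 2 := by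
    intro t
    rw [norm_add_sq_real, norm_smul, he, inner_smul_right]
    simp
    ring
  have hev : ∀ᶠ y in 𝓝 x, ContDiffAt ℝ 2 f y := hf.eventually (by simp)
  have hevt : ∀ᶠ t in 𝓝 (0 : ℝ), ContDiffAt ℝ 2 f (x + t • e) := by
    have : Filter.Tendsto (fun t : ℝ => x + t • e) (𝓝 0) (𝓝 x) := by
      simpa [ContinuousAt] using hcl
    exact this.eventually hev
  have hd : deriv h =ᶠ[𝓝 0] fun t =>
      fderiv ℝ f (x + t • e) e + ε * (2 * inner ℝ x e + 2 * t) := by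
    filter_upwards [hevt] with t ht
    have hlt : HasDerivAt (fun t : ℝ => x + t • e) e t := by
      simpa using ((hasDerivAt_id t).smul_const e).const_add x
    have h1 := (ht.differentiableAt (by simp)).hasFDerivAt.comp_hasDerivAt t hlt
    have h2 : HasDerivAt (fun t : ℝ => ‖x‖ ^ 2 + 2 * t * inner ℝ x e + t ^ 2)
        (2 * inner ℝ x e + 2 * t) t := by
      have := ((((hasDerivAt_id t).const_mul 2).mul_const (inner ℝ x e)).const_add
        (‖x‖ ^ 2)).add (hasDerivAt_pow 2 t)
      exact this.congr_deriv (by simp)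
    have h3 := h1.add (h2.const_mul ε)
    have : h = fun t => (f ∘ fun t : ℝ => x + t • e) t +
        ε * (‖x‖ ^ 2 + 2 * t * inner ℝ x e + t ^ 2) := by
      funext s
      simp [hh, hsq]
    rw [this]
    exact h3.deriv
  have hdd : deriv (deriv h) 0 = iteratedFDeriv ℝ 2 f x ![e, e] + 2 * ε := by
    rw [hd.deriv_eq]
    have hF : DifferentiableAt ℝ (fderiv ℝ f) (x + (0 : ℝ) • e) := by
      rw [hx]
      exact (hf.fderiv_right (m := 1) (by norm_num)).differentiableAt (by simp)
    have h1 : HasDerivAt (fun t : ℝ => fderiv ℝ f (x + t • e) e)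
        (fderiv ℝ (fderiv ℝ f) x e e) 0 := by
      have hF' : HasFDerivAt (fun y => fderiv ℝ f y e)
          ((ContinuousLinearMap.apply ℝ ℝ e).comp (fderiv ℝ (fderiv ℝ f) x)) (x + (0 : ℝ) • e) := by
        rw [hx] at hF ⊢
        exact (ContinuousLinearMap.apply ℝ ℝ e).hasFDerivAt.comp x hF.hasFDerivAt
      exact hF'.comp_hasDerivAt (0 : ℝ) hl
    have h2 : HasDerivAt (fun t : ℝ => ε * (2 * inner ℝ x e + 2 * t)) (ε * 2) 0 := by
      simpa using (((hasDerivAt_id (0 : ℝ)).const_mul 2).const_add (2 * inner ℝ x e)).const_mul ε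
    rw [iteratedFDeriv_two_apply, mul_comm 2 ε]
    exact (h1.add h2).deriv
  have hc : ContinuousAt h 0 := by
    have : ContinuousAt f (x + (0 : ℝ) • e) := by rw [hx]; exact hf.continuousAt
    have h1 : ContinuousAt (fun t : ℝ => f (x + t • e)) 0 :=
      ContinuousAt.comp (f := fun t : ℝ => x + t • e) this hcl
    exact h1.add (by fun_prop)
  linarith [hmax.deriv_deriv_nonpos hc]

/-- Perturb by `ε ‖y‖²`. At an interior maximum both pure second derivatives of `f` are at most
`-2ε`, which contradicts a zero Laplacian. -/
theorem le_of_harmonicOnNhd_of_le_frontier {D : Set Plane} (ho : IsOpen D)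
    (hb : Bornology.IsBounded D) {f : Plane → ℝ} (hf : InnerProductSpace.HarmonicOnNhd f D)
    (hc : ContinuousOn f (closure D)) {M : ℝ} (hM : ∀ x ∈ frontier D, f x ≤ M) :
    ∀ x ∈ D, f x ≤ M := by
  intro x hx
  by_contra! hlt
  obtain ⟨R, hR⟩ := hb.closure.exists_norm_le
  have hRx := (norm_nonneg _).trans (hR x (subset_closure hx))
  -- Small enough that `M + ε R² < f x`, so the perturbed function cannot attain its maximum on the
  -- frontier.
  set ε : ℝ := (f x - M) / (2 * (R ^ 2 + 1)) with hε
  have hε0 : 0 < ε := by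
    have := sub_pos.mpr hlt
    positivity
  have hεR : ε * R ^ 2 < f x - M := by
    have h1 : ε * (2 * (R ^ 2 + 1)) = f x - M := by
      rw [hε]; field_simp
    nlinarith [mul_nonneg hε0.le (sq_nonneg R)]
  obtain ⟨z, hz, hmax⟩ := hb.isCompact_closure.exists_isMaxOn
    (f := fun y => f y + ε * ‖y‖ ^ 2) ⟨x, subset_closure hx⟩ (hc.add (by fun_prop))
  have hxz := hmax (subset_closure hx)
  simp only [Set.mem_ofPred_eq] at hxz
  have hzR : ‖z‖ ^ 2 ≤ R ^ 2 := pow_le_pow_left₀ (norm_nonneg _) (hR z hz) 2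
  by_cases hzD : z ∈ D
  · have hloc : IsLocalMax (fun y => f y + ε * ‖y‖ ^ 2) z :=
      (hmax.on_subset subset_closure).isLocalMax (ho.mem_nhds hzD)
    obtain ⟨hC, hL⟩ := hf z hzD
    have hL0 := hL.self_of_nhds
    rw [InnerProductSpace.laplacian_eq_iteratedFDeriv_orthonormalBasis f
      (EuclideanSpace.basisFun (Fin 2) ℝ)] at hL0
    simp only [Fin.sum_univ_two, Pi.zero_apply] at hL0
    have h0 := iteratedFDeriv_two_le_of_isLocalMax hC
      ((EuclideanSpace.basisFun (Fin 2) ℝ).norm_eq_one 0) hloc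
    have h1 := iteratedFDeriv_two_le_of_isLocalMax hC
      ((EuclideanSpace.basisFun (Fin 2) ℝ).norm_eq_one 1) hloc
    linarith
  · have := hM z ⟨hz, by rwa [ho.interior_eq]⟩
    nlinarith [mul_le_mul_of_nonneg_left hzR hε0.le, mul_nonneg hε0.le (sq_nonneg ‖x‖)]

theorem abs_le_of_harmonicOnNhd_of_abs_le_frontier {D : Set Plane} (ho : IsOpen D)
    (hb : Bornology.IsBounded D) {f : Plane → ℝ} (hf : InnerProductSpace.HarmonicOnNhd f D)
    (hc : ContinuousOn f (closure D)) {M : ℝ} (hM : ∀ x ∈ frontier D, |f x| ≤ M) :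
    ∀ x ∈ D, |f x| ≤ M := by
  intro x hx
  rw [abs_le]
  refine ⟨?_, le_of_harmonicOnNhd_of_le_frontier ho hb hf hc
    (fun y hy => (abs_le.mp (hM y hy)).2) x hx⟩
  have := le_of_harmonicOnNhd_of_le_frontier ho hb hf.neg hc.neg
    (fun y hy => neg_le.mp (abs_le.mp (hM y hy)).1) x hx
  simp only [Pi.neg_apply] at this
  linarith

theorem harmonicOnNhd_affineMap (q : Plane →ᵃ[ℝ] ℝ) (D : Set Plane) :
    InnerProductSpace.HarmonicOnNhd q D := by
  intro x _
  have hq : ∀ y, HasFDerivAt q (LinearMap.toContinuousLinearMap q.linear) y := by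
    intro y
    have h := ((LinearMap.toContinuousLinearMap q.linear).hasFDerivAt (x := y)).add_const (q 0)
    have he : (q : Plane → ℝ) = fun z => LinearMap.toContinuousLinearMap q.linear z + q 0 := by
      funext z
      simpa using congrFun q.decomp z
    rwa [← he] at h
  have hf : fderiv ℝ q = fun _ => LinearMap.toContinuousLinearMap q.linear :=
    funext fun y => (hq y).fderiv
  refine ⟨?_, Filter.Eventually.of_forall fun y => ?_⟩
  · have : ContDiff ℝ 2 q := by
      have h : ContDiff ℝ 2 fun z => LinearMap.toContinuousLinearMap q.linear z + q 0 := by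
        fun_prop
      convert h using 1
      funext z
      simpa using congrFun q.decomp z
    exact this.contDiffAt
  · rw [InnerProductSpace.laplacian_eq_iteratedFDeriv_stdOrthonormalBasis]
    simp [iteratedFDeriv_two_apply, hf]

/-! ### Weak and classical gradients -/

/-- The seminorm is built on a chosen weak gradient, whereas the estimates along segments use the
classical derivative. Classical integration by parts against test functions and the fundamental
lemma of the calculus of variations identify the two. -/
theorem IsWeakGrad.ae_fderiv_eq {D : Set Plane} (ho : IsOpen D) {v : Plane → ℝ}
    {g : Plane → Plane} (hg : IsWeakGrad D v g) (hv : ContDiffOn ℝ 1 v D) (i : Fin 2) :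
    ∀ᵐ x, x ∈ D → fderiv ℝ v x (EuclideanSpace.single i 1) - g x i = 0 := by
  have hvc : ContinuousOn v D := hv.continuousOn
  have hvd : ∀ x ∈ D, DifferentiableAt ℝ v x := fun x hx =>
    (hv.contDiffAt (ho.mem_nhds hx)).differentiableAt (by simp)
  have hfc : ContinuousOn (fun x => fderiv ℝ v x (EuclideanSpace.single i 1)) D :=
    (hv.continuousOn_fderiv_of_isOpen ho (by simp)).clm_apply continuousOn_const
  have hgi : MemLp (fun x => g x i) 2 (volume.restrict D) :=
    (EuclideanSpace.proj (𝕜 := ℝ) i).comp_memLp' hg.1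
  have hloc : LocallyIntegrableOn (fun x => g x i) D :=
    locallyIntegrableOn_of_locallyIntegrable_restrict (hgi.locallyIntegrable (by norm_num))
  refine ho.ae_eq_zero_of_integral_contDiff_smul_eq_zero
    ((hfc.locallyIntegrableOn ho.measurableSet).sub hloc) ?_
  intro φ hφ hφc hφD
  -- `w` is controlled only in `D`, but the support of `ψ` is a compact subset of `D`, so the
  -- product is continuous on the whole plane.
  have hext : ∀ (w ψ : Plane → ℝ), ContinuousOn w D → Continuous ψ → tsupport ψ ⊆ tsupport φ →
      Integrable (fun x => w x * ψ x) := by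
    intro w ψ hw hψ hs
    have hsup : tsupport (fun x => w x * ψ x) ⊆ tsupport ψ :=
      closure_mono (Function.support_mul_subset_right _ _)
    refine Continuous.integrable_of_hasCompactSupport ?_
      (hφc.of_isClosed_subset (isClosed_tsupport _) (hsup.trans hs))
    refine continuous_of_tsupport fun x hx => ?_
    have hxD := hφD (hs (hsup hx))
    exact (hw.continuousAt (ho.mem_nhds hxD)).mul hψ.continuousAt
  have hφ1 : Continuous fun x => fderiv ℝ φ x (EuclideanSpace.single i 1) :=
    (hφ.continuous_fderiv (by simp)).clm_apply continuous_const
  have hφ1s : tsupport (fun x => fderiv ℝ φ x (EuclideanSpace.single i 1)) ⊆ tsupport φ :=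
    tsupport_fderiv_apply_subset ℝ _
  have hibp := integral_mul_fderiv_eq_neg_fderiv_mul_of_integrable (μ := (volume : Measure Plane))
    (v := EuclideanSpace.single i (1 : ℝ))
    (hext _ φ hfc hφ.continuous subset_rfl) (hext v _ hvc hφ1 hφ1s)
    (hext v φ hvc hφ.continuous subset_rfl)
    (fun x hx => hvd x (hφD hx)) (fun x _ => hφ.differentiable (by simp) x)
  have hw := hg.2 φ ⟨hφ, hφc, hφD⟩ i
  have hout : ∀ (w ψ : Plane → ℝ), tsupport ψ ⊆ D →
      ∫ x in D, w x * ψ x = ∫ x, w x * ψ x := by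
    intro w ψ hs
    refine setIntegral_eq_integral_of_forall_compl_eq_zero fun x hx => ?_
    rw [image_eq_zero_of_notMem_tsupport fun h => hx (hs h), mul_zero]
  rw [hout _ _ (hφ1s.trans hφD), hout _ _ hφD, hibp, neg_inj] at hw
  have hgφ : Integrable fun x => g x i * φ x := by
    rw [← integrableOn_iff_integrable_of_support_subset (s := D)]
    · exact hgi.integrable_mul ((hφ.continuous.memLp_of_hasCompactSupport (p := 2) hφc).restrict D)
    · exact (Function.support_mul_subset_right _ _).trans ((subset_tsupport φ).trans hφD)
  rw [← sub_eq_zero, ← integral_sub (hext _ φ hfc hφ.continuous subset_rfl) hgφ] at hw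
  rw [← hw]
  refine integral_congr_ae (Filter.Eventually.of_forall fun x => ?_)
  simp
  ring

theorem norm_le_of_forall_apply_single {L : Plane →L[ℝ] ℝ} {y : Plane}
    (h : ∀ i, L (EuclideanSpace.single i 1) - y i = 0) : ‖L‖ ≤ ‖y‖ := by
  have : L = innerSL ℝ y := by
    refine ContinuousLinearMap.coe_injective
      ((EuclideanSpace.basisFun (Fin 2) ℝ).toBasis.ext fun i => ?_)
    have := sub_eq_zero.mp (h i)
    simpa [EuclideanSpace.inner_single_right] using this
  rw [this, innerSL_apply_norm]

/-- With a lower integral on the left, the classical gradient needs no integrability argument, here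
or in the later Fubini steps. -/
theorem lintegral_fderiv_sq_le {D : Set Plane} (ho : IsOpen D) {v : Plane → ℝ}
    (hv : MemH1 D v) (hv1 : ContDiffOn ℝ 1 v D) :
    ∫⁻ x in D, ENNReal.ofReal (‖fderiv ℝ v x‖ ^ 2) ≤ ENNReal.ofReal (h1Seminorm D v ^ 2) := by
  have hg := isWeakGrad_weakGrad hv
  have hae : ∀ᵐ x ∂volume.restrict D, ‖fderiv ℝ v x‖ ≤ ‖weakGrad D v x‖ := by
    rw [ae_restrict_iff' ho.measurableSet]
    filter_upwards [ae_all_iff.mpr (hg.ae_fderiv_eq ho hv1)] with x hx hxD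
    exact norm_le_of_forall_apply_single fun i => hx i hxD
  rw [h1Seminorm, l2Norm, Real.sq_sqrt (integral_nonneg fun x => by positivity),
    ofReal_integral_eq_lintegral_ofReal ((memLp_two_iff_integrable_sq_norm hg.1.1).mp hg.1)
      (Filter.Eventually.of_forall fun x => by positivity)]
  refine lintegral_mono_ae ?_
  filter_upwards [hae] with x hx
  gcongr

end VEM

namespace VEM

/-! ### Integration over a half triangle -/

/-- The determinant of two vectors of the plane. -/
def cross (e d : Plane) : ℝ := e 0 * d 1 - e 1 * d 0

/-- The right triangle with vertices `(0, 0)`, `(1/2, 0)` and `(0, 1)`. -/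
def refTriangle : Set (ℝ × ℝ) := {p | 0 < p.1 ∧ p.1 < 1 / 2 ∧ 0 < p.2 ∧ p.2 < 1 - 2 * p.1}

theorem isOpen_refTriangle : IsOpen refTriangle := by
  refine (isOpen_lt continuous_const continuous_fst).inter
    ((isOpen_lt continuous_fst continuous_const).inter
      ((isOpen_lt continuous_const continuous_snd).inter
        (isOpen_lt continuous_snd (by fun_prop))))

/-- The open triangle with vertices `a`, `a + e / 2` and `a + d`. -/
def halfTriangle (a e d : Plane) : Set Plane :=
  (fun p : ℝ × ℝ => a + p.1 • e + p.2 • d) '' refTriangle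

/-- The linear map `(s, t) ↦ s e + t d`. -/
noncomputable def combCLM (e d : Plane) : Plane →L[ℝ] Plane :=
  (EuclideanSpace.proj 0 : Plane →L[ℝ] ℝ).smulRight e +
    (EuclideanSpace.proj 1 : Plane →L[ℝ] ℝ).smulRight d

theorem combCLM_apply (e d p : Plane) : combCLM e d p = p 0 • e + p 1 • d := rfl

theorem det_combCLM (e d : Plane) : (combCLM e d).det = cross e d := by
  rw [ContinuousLinearMap.det, ← LinearMap.det_toMatrix (EuclideanSpace.basisFun (Fin 2) ℝ).toBasis,
    Matrix.det_fin_two]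
  simp [LinearMap.toMatrix_apply, combCLM_apply, cross]
  ring

theorem combCLM_injective {e d : Plane} (h : cross e d ≠ 0) :
    Function.Injective (combCLM e d) := by
  have : LinearMap.det (combCLM e d : Plane →ₗ[ℝ] Plane) ≠ 0 := by
    rw [← det_combCLM] at h
    exact h
  exact (LinearMap.equivOfDetNeZero _ this).injective

theorem lintegral_halfTriangle (a : Plane) {e d : Plane} (h : cross e d ≠ 0)
    (G : Plane → ENNReal) :
    ∫⁻ x in halfTriangle a e d, G x =
      ENNReal.ofReal |cross e d| * ∫⁻ p in refTriangle, G (a + p.1 • e + p.2 • d) := by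
  have hmp := (volume_preserving_finTwoArrow ℝ).comp (PiLp.volume_preserving_ofLp (Fin 2))
  set ψ : Plane → ℝ × ℝ := fun x => (x 0, x 1) with hψ
  have hmp' : MeasurePreserving ψ volume volume := hmp
  have hemb : MeasurableEmbedding ψ :=
    ((MeasurableEquiv.toLp 2 (Fin 2 → ℝ)).symm.trans MeasurableEquiv.finTwoArrow).measurableEmbedding
  have himg : halfTriangle a e d = (fun x => a + combCLM e d x) '' (ψ ⁻¹' refTriangle) := by
    ext y
    constructor
    · rintro ⟨p, hp, rfl⟩
      exact ⟨!₂[p.1, p.2], by simpa [hψ] using hp, by simp [combCLM_apply, add_assoc]⟩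
    · rintro ⟨x, hx, rfl⟩
      exact ⟨ψ x, hx, by simp [hψ, combCLM_apply, add_assoc]⟩
  rw [himg, lintegral_image_eq_lintegral_abs_det_fderiv_mul (f' := fun _ => combCLM e d) volume
    (hmp'.measurable isOpen_refTriangle.measurableSet)
    (fun x _ => ((combCLM e d).hasFDerivAt.const_add a).hasFDerivWithinAt)
    (fun x _ y _ hxy => combCLM_injective h (add_left_cancel hxy)), det_combCLM,
    lintegral_const_mul' _ _ ENNReal.ofReal_ne_top,
    ← hmp'.setLIntegral_comp_preimage_emb hemb (fun p => G (a + p.1 • e + p.2 • d))]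
  simp [hψ, combCLM_apply, add_assoc]

theorem lintegral_refTriangle {F : ℝ × ℝ → ENNReal} (hF : Measurable F) :
    ∫⁻ p in refTriangle, F p =
      ∫⁻ u in Set.Ioo (0 : ℝ) (1 / 2), ∫⁻ s in Set.Ioo (0 : ℝ) (1 - 2 * u), F (u, s) := by
  rw [← lintegral_indicator isOpen_refTriangle.measurableSet, Measure.volume_eq_prod,
    lintegral_prod _ (hF.indicator isOpen_refTriangle.measurableSet).aemeasurable,
    ← lintegral_indicator measurableSet_Ioo]
  refine lintegral_congr fun u => ?_
  by_cases hu : u ∈ Set.Ioo (0 : ℝ) (1 / 2)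
  · rw [Set.indicator_of_mem hu, ← lintegral_indicator measurableSet_Ioo]
    refine lintegral_congr fun s => ?_
    by_cases hs : s ∈ Set.Ioo (0 : ℝ) (1 - 2 * u)
    · rw [Set.indicator_of_mem hs, Set.indicator_of_mem]
      exact ⟨hu.1, hu.2, hs.1, hs.2⟩
    · rw [Set.indicator_of_notMem hs, Set.indicator_of_notMem]
      exact fun h => hs ⟨h.2.2.1, h.2.2.2⟩
  · rw [Set.indicator_of_notMem hu]
    refine (lintegral_congr fun s => ?_).trans lintegral_zero
    exact Set.indicator_of_notMem (fun h => hu ⟨h.1, h.2.1⟩) _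

/-- The inner domain varies with `u`; moving it into an indicator reduces the claim to measurability
of integrals over a fixed space. -/
theorem measurable_lintegral_Ioo {F : ℝ × ℝ → ENNReal} (hF : Measurable F) :
    Measurable fun u : ℝ => ∫⁻ s in Set.Ioo (0 : ℝ) (1 - 2 * u), F (u, s) := by
  have hS : MeasurableSet {p : ℝ × ℝ | 0 < p.2 ∧ p.2 < 1 - 2 * p.1} :=
    ((isOpen_lt continuous_const continuous_snd).inter
      (isOpen_lt continuous_snd (by fun_prop))).measurableSet
  convert (hF.indicator hS).lintegral_prod_right' (ν := volume) using 2 with u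
  rw [← lintegral_indicator measurableSet_Ioo]
  rfl

theorem lintegral_Ioo_one_sub_two_mul :
    ∫⁻ u in Set.Ioo (0 : ℝ) (1 / 2), ENNReal.ofReal (1 - 2 * u) = ENNReal.ofReal (1 / 4) := by
  rw [← ofReal_integral_eq_lintegral_ofReal]
  · rw [← integral_Ioc_eq_integral_Ioo, ← intervalIntegral.integral_of_le (by norm_num)]
    congr 1
    have h2 : IntervalIntegrable (fun u : ℝ => 2 * u) volume 0 (1 / 2) :=
      (by fun_prop : Continuous fun u : ℝ => 2 * u).intervalIntegrable _ _
    rw [intervalIntegral.integral_sub intervalIntegrable_const h2,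
      intervalIntegral.integral_const_mul]
    norm_num
  · exact ((continuous_const.sub (continuous_const.mul continuous_id)).integrableOn_Icc
      (a := 0) (b := 1 / 2)).mono_set Set.Ioo_subset_Icc_self
  · filter_upwards [self_mem_ae_restrict measurableSet_Ioo] with u hu
    simp only [Pi.zero_apply]
    linarith [hu.2]

theorem volume_halfTriangle (a : Plane) {e d : Plane} (h : cross e d ≠ 0) :
    volume (halfTriangle a e d) = ENNReal.ofReal (|cross e d| / 4) := by
  have h1 := lintegral_halfTriangle a h fun _ => 1
  rw [lintegral_refTriangle measurable_const] at h1
  simp only [lintegral_one, Measure.restrict_apply MeasurableSet.univ, Set.univ_inter,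
    Real.volume_Ioo, sub_zero] at h1
  rw [h1, lintegral_Ioo_one_sub_two_mul, ← ENNReal.ofReal_mul (abs_nonneg _)]
  congr 1
  ring

theorem isOpen_halfTriangle (a : Plane) {e d : Plane} (h : cross e d ≠ 0) :
    IsOpen (halfTriangle a e d) := by
  have himg : halfTriangle a e d =
      (fun x => a + x) '' (combCLM e d '' {x | (x 0, x 1) ∈ refTriangle}) := by
    ext y
    constructor
    · rintro ⟨p, hp, rfl⟩
      exact ⟨_, ⟨!₂[p.1, p.2], by simpa using hp, rfl⟩, by simp [combCLM_apply, add_assoc]⟩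
    · rintro ⟨_, ⟨x, hx, rfl⟩, rfl⟩
      exact ⟨_, hx, by simp [combCLM_apply, add_assoc]⟩
  rw [himg]
  have hs := LinearMap.injective_iff_surjective.mp
    (show Function.Injective (combCLM e d : Plane →ₗ[ℝ] Plane) from combCLM_injective h)
  exact isOpenMap_add_left a _ ((combCLM e d).isOpenMap hs _
    (isOpen_refTriangle.preimage (by fun_prop)))

/-! ### The increment over an edge of a triangle -/

/-- Differentiability may fail at the endpoints, so the estimate is taken on `[ε, l - ε]` and `ε`
tends to zero by continuity. -/
theorem enorm_sub_le_lintegral_deriv_Ioo {w : ℝ → ℝ} {l : ℝ} (hl : 0 < l)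
    (hc : ContinuousOn w (Set.Icc 0 l)) (hd : ContDiffOn ℝ 1 w (Set.Ioo 0 l)) :
    ‖w l - w 0‖ₑ ≤ ∫⁻ s in Set.Ioo 0 l, ‖deriv w s‖ₑ := by
  have h0 : Filter.Tendsto w (𝓝[>] 0) (𝓝 (w 0)) :=
    (hc 0 ⟨le_rfl, hl.le⟩).mono_left (by
      rw [← nhdsWithin_Ioo_eq_nhdsGT hl]
      exact nhdsWithin_mono _ Set.Ioo_subset_Icc_self)
  have h1 : Filter.Tendsto (fun ε => w (l - ε)) (𝓝[>] 0) (𝓝 (w l)) := by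
    have h2 : Filter.Tendsto w (𝓝[<] l) (𝓝 (w l)) :=
      (hc l ⟨hl.le, le_rfl⟩).mono_left (by
        rw [← nhdsWithin_Ioo_eq_nhdsLT hl]
        exact nhdsWithin_mono _ Set.Ioo_subset_Icc_self)
    refine h2.comp (tendsto_nhdsWithin_iff.mpr ⟨?_, ?_⟩)
    · have : Filter.Tendsto (fun ε : ℝ => l - ε) (𝓝 0) (𝓝 (l - 0)) := by
        exact (continuous_const.sub continuous_id).tendsto 0
      rw [sub_zero] at this
      exact this.mono_left nhdsWithin_le_nhds
    · filter_upwards [self_mem_nhdsWithin] with ε hε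
      have : 0 < ε := hε
      simp only [Set.mem_Iio]
      linarith
  refine le_of_tendsto (h1.sub h0).enorm ?_
  filter_upwards [Ioo_mem_nhdsGT (half_pos hl)] with ε hε
  have hsub : Set.Icc ε (l - ε) ⊆ Set.Ioo 0 l := fun s hs =>
    ⟨hε.1.trans_le hs.1, hs.2.trans_lt (by linarith [hε.1])⟩
  exact (enorm_sub_le_lintegral_deriv_of_contDiffOn_Icc (hd.mono hsub)
    (by linarith [hε.2])).trans (lintegral_mono_set hsub)

/-- Young's inequality `‖∇v‖ ‖d‖ ≤ c + ‖d‖² ‖∇v‖² / (4c)` under the integral. It stands in for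
Cauchy–Schwarz, and the free parameter `c` is later tuned to absorb the linear term. -/
theorem enorm_sub_le_of_segment {D : Set Plane} (ho : IsOpen D) {v : Plane → ℝ}
    (hv : ContDiffOn ℝ 1 v D) (hc : ContinuousOn v (closure D)) {y d : Plane} {l c : ℝ}
    (hl : 0 < l) (hlam : 0 < c) (hD : ∀ s, 0 < s → s < l → y + s • d ∈ D) :
    ‖v (y + l • d) - v y‖ₑ ≤ ENNReal.ofReal (c * l) + ENNReal.ofReal (‖d‖ ^ 2 / (4 * c)) *
      ∫⁻ s in Set.Ioo 0 l, ENNReal.ofReal (‖fderiv ℝ v (y + s • d)‖ ^ 2) := by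
  have hpath : ∀ s : ℝ, HasDerivAt (fun t : ℝ => y + t • d) d s := fun s => by
    simpa using ((hasDerivAt_id s).smul_const d).const_add y
  have hmaps : Set.MapsTo (fun s : ℝ => y + s • d) (Set.Ioo 0 l) D := fun s hs => hD s hs.1 hs.2
  have hcp : Continuous fun s : ℝ => y + s • d := by fun_prop
  have hmapsc : Set.MapsTo (fun s : ℝ => y + s • d) (Set.Icc 0 l) (closure D) := by
    rw [← closure_Ioo hl.ne]
    exact hmaps.closure hcp
  have h := enorm_sub_le_lintegral_deriv_Ioo (w := fun s => v (y + s • d)) hl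
    (hc.comp hcp.continuousOn hmapsc)
    (hv.comp (by fun_prop : ContDiff ℝ 1 fun s : ℝ => y + s • d).contDiffOn hmaps)
  simp only [zero_smul, add_zero] at h
  refine h.trans ?_
  rw [← lintegral_const_mul' _ _ ENNReal.ofReal_ne_top]
  have hcl : ENNReal.ofReal (c * l) = ∫⁻ _ in Set.Ioo 0 l, ENNReal.ofReal c := by
    rw [setLIntegral_const, Real.volume_Ioo, sub_zero, ENNReal.ofReal_mul hlam.le]
  rw [hcl, ← lintegral_add_left measurable_const]
  refine setLIntegral_mono' measurableSet_Ioo fun s hs => ?_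
  have hdv : DifferentiableAt ℝ v (y + s • d) :=
    (hv.contDiffAt (ho.mem_nhds (hmaps hs))).differentiableAt (by simp)
  have hder : deriv (fun s => v (y + s • d)) s = fderiv ℝ v (y + s • d) d :=
    (hdv.hasFDerivAt.comp_hasDerivAt s (hpath s)).deriv
  rw [hder, ← ENNReal.ofReal_mul (by positivity), ← ENNReal.ofReal_add hlam.le (by positivity),
    ← ofReal_norm]
  refine ENNReal.ofReal_le_ofReal (((fderiv ℝ v (y + s • d)).le_opNorm d).trans ?_)
  have h4 : (4 * c) * (‖fderiv ℝ v (y + s • d)‖ * ‖d‖) ≤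
      (4 * c) * c + ‖d‖ ^ 2 * ‖fderiv ℝ v (y + s • d)‖ ^ 2 := by
    nlinarith [sq_nonneg (2 * c - ‖fderiv ℝ v (y + s • d)‖ * ‖d‖)]
  have h5 : c + ‖d‖ ^ 2 / (4 * c) * ‖fderiv ℝ v (y + s • d)‖ ^ 2 =
      ((4 * c) * c + ‖d‖ ^ 2 * ‖fderiv ℝ v (y + s • d)‖ ^ 2) / (4 * c) := by
    field_simp
  rw [h5, le_div_iff₀ (by positivity)]
  linarith

/-- For `0 < u < 1/2`, the edge points at parameters `u` and `1 - u` are joined through one point of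
the triangle by segments parallel to `c - a` and `c - b`. Affinity on the edge makes the increment
between them `(1 - 2u)(v b - v a)`. As `u` varies, each family of segments sweeps out a half
triangle, so integrating in `u` turns line integrals of `‖∇v‖²` into area integrals. -/
theorem sq_sub_mul_cross_le {D : Set Plane} (ho : IsOpen D) {v : Plane → ℝ}
    (hv : ContDiffOn ℝ 1 v D) (hc : ContinuousOn v (closure D)) {a b c : Plane} {h S : ℝ}
    (ha : ‖c - a‖ ≤ h) (hb : ‖c - b‖ ≤ h) (hJ : cross (b - a) (c - a) ≠ 0)
    (hT : ∀ u s : ℝ, 0 < u → 0 < s → u + s < 1 → a + u • (b - a) + s • (c - a) ∈ D)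
    (hE : ∃ q : Plane →ᵃ[ℝ] ℝ, ∀ u : ℝ, 0 ≤ u → u ≤ 1 →
      v (a + u • (b - a)) = q (a + u • (b - a)))
    (hS : ∫⁻ x in D, ENNReal.ofReal (‖fderiv ℝ v x‖ ^ 2) ≤ ENNReal.ofReal (S ^ 2)) :
    (v b - v a) ^ 2 * |cross (b - a) (c - a)| ≤ 16 * h ^ 2 * S ^ 2 := by
  obtain ⟨q, hq⟩ := hE
  set δ : ℝ := |v b - v a| with hδ
  -- The Young parameter will be `δ / 4`, which has to be positive.
  rcases eq_or_lt_of_le (abs_nonneg (v b - v a)) with h0 | hpos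
  · rw [abs_eq_zero.mp h0.symm]
    simp
    positivity
  have hqa : ∀ u : ℝ, 0 ≤ u → u ≤ 1 → v (a + u • (b - a)) = v a + u * (v b - v a) := by
    have hlin : ∀ u : ℝ, q (a + u • (b - a)) = q a + u * q.linear (b - a) := by
      intro u
      have : q ((u • (b - a)) +ᵥ a) = q.linear (u • (b - a)) +ᵥ q a := q.map_vadd a _
      simpa [add_comm] using this
    have h1 := hq 0 le_rfl zero_le_one
    have h2 := hq 1 zero_le_one le_rfl
    rw [hlin] at h1 h2
    simp only [zero_smul, add_zero, zero_mul, one_smul, add_sub_cancel, one_mul] at h1 h2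
    intro u hu0 hu1
    rw [hq u hu0 hu1, hlin, h1, h2]
    ring
  have hJ' : cross (a - b) (c - b) = -cross (b - a) (c - a) := by
    simp [cross]
    ring
  set F : Plane → ENNReal := fun x => ENNReal.ofReal (‖fderiv ℝ v x‖ ^ 2) with hF
  have hFm : Measurable F := ((measurable_fderiv ℝ v).norm.pow_const 2).ennreal_ofReal
  have hA : ∀ (a e d : Plane), Measurable fun p : ℝ × ℝ => F (a + p.1 • e + p.2 • d) :=
    fun a e d => hFm.comp (by fun_prop)
  set A : ℝ → ENNReal := fun u =>
    ∫⁻ s in Set.Ioo (0 : ℝ) (1 - 2 * u), F (a + u • (b - a) + s • (c - a)) with hAdef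
  set B : ℝ → ENNReal := fun u =>
    ∫⁻ s in Set.Ioo (0 : ℝ) (1 - 2 * u), F (b + u • (a - b) + s • (c - b)) with hBdef
  have hK : ∀ (a e d : Plane), cross e d ≠ 0 → halfTriangle a e d ⊆ D →
      ENNReal.ofReal |cross e d| * ∫⁻ u in Set.Ioo (0 : ℝ) (1 / 2),
        ∫⁻ s in Set.Ioo (0 : ℝ) (1 - 2 * u), F (a + u • e + s • d) ≤ ENNReal.ofReal (S ^ 2) := by
    intro a e d hed hsub
    rw [← lintegral_refTriangle (F := fun p => F (a + p.1 • e + p.2 • d)) (hA a e d),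
      ← lintegral_halfTriangle a hed]
    exact (lintegral_mono_set hsub).trans hS
  have hsymm : ∀ u s : ℝ, b + u • (a - b) + s • (c - b) =
      a + (1 - u - s) • (b - a) + s • (c - a) := by
    intro u s
    module
  have hAS := hK a (b - a) (c - a) hJ (by
    rintro _ ⟨p, ⟨h1, h2, h3, h4⟩, rfl⟩
    exact hT _ _ h1 h3 (by linarith))
  have hBS := hK b (a - b) (c - b) (by rw [hJ']; exact neg_ne_zero.mpr hJ) (by
    rintro _ ⟨p, ⟨h1, h2, h3, h4⟩, rfl⟩
    simp only [hsymm]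
    exact hT _ _ (by linarith) h3 (by linarith))
  rw [hJ', abs_neg] at hBS
  set J : ℝ := |cross (b - a) (c - a)| with hJdef
  have hpt : ∀ u ∈ Set.Ioo (0 : ℝ) (1 / 2),
      ENNReal.ofReal (δ / 2) * ENNReal.ofReal (1 - 2 * u) ≤
        ENNReal.ofReal (h ^ 2 / δ) * (A u + B u) := by
    intro u hu
    have hl : 0 < 1 - 2 * u := by linarith [hu.2]
    -- With parameter `δ / 4`, the linear terms of the two segments add up to half of `δ (1 - 2u)`
    -- and are absorbed on the left.
    have h1 := enorm_sub_le_of_segment ho hv hc (y := a + u • (b - a)) (d := c - a) hl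
      (show 0 < δ / 4 by positivity) (fun s hs0 hs1 => hT u s hu.1 hs0 (by linarith [hu.1]))
    have h2 := enorm_sub_le_of_segment ho hv hc (y := b + u • (a - b)) (d := c - b) hl
      (show 0 < δ / 4 by positivity) (fun s hs0 hs1 => by
        rw [hsymm]
        exact hT _ s (by linarith [hu.1]) hs0 (by linarith [hu.1]))
    have hz : b + u • (a - b) + (1 - 2 * u) • (c - b) =
        a + u • (b - a) + (1 - 2 * u) • (c - a) := by
      rw [hsymm]
      module
    rw [hz] at h2
    set z := a + u • (b - a) + (1 - 2 * u) • (c - a)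
    have hvb : v (b + u • (a - b)) - v (a + u • (b - a)) = (1 - 2 * u) * (v b - v a) := by
      have : b + u • (a - b) = a + (1 - u) • (b - a) := by module
      rw [this, hqa _ (by linarith [hu.2]) (by linarith [hu.1]), hqa _ hu.1.le (by linarith [hu.2])]
      ring
    have hδl : ENNReal.ofReal (δ * (1 - 2 * u)) ≤
        ‖v z - v (a + u • (b - a))‖ₑ + ‖v z - v (b + u • (a - b))‖ₑ := by
      have h3 : (1 - 2 * u) * (v b - v a) =
          (v z - v (a + u • (b - a))) - (v z - v (b + u • (a - b))) := by
        rw [← hvb]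
        ring
      have h4 : ENNReal.ofReal (δ * (1 - 2 * u)) = ‖(1 - 2 * u) * (v b - v a)‖ₑ := by
        rw [← ofReal_norm, norm_mul, Real.norm_of_nonneg hl.le, mul_comm]
        rfl
      rw [h4, h3]
      exact enorm_sub_le
    have hcoef : ∀ d : Plane, ‖d‖ ≤ h →
        ENNReal.ofReal (‖d‖ ^ 2 / (4 * (δ / 4))) ≤ ENNReal.ofReal (h ^ 2 / δ) := by
      intro d hd
      rw [show 4 * (δ / 4) = δ by ring]
      gcongr
    have h5 := (hδl.trans (add_le_add h1 h2)).trans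
      (add_le_add (add_le_add le_rfl (mul_le_mul_left (hcoef _ ha) _))
        (add_le_add le_rfl (mul_le_mul_left (hcoef _ hb) _)))
    have h6 : ENNReal.ofReal (δ * (1 - 2 * u)) = ENNReal.ofReal (δ / 4 * (1 - 2 * u)) +
        ENNReal.ofReal (δ / 4 * (1 - 2 * u)) + ENNReal.ofReal (δ / 2 * (1 - 2 * u)) := by
      rw [← ENNReal.ofReal_add (by positivity) (by positivity),
        ← ENNReal.ofReal_add (by positivity) (by positivity)]
      congr 1
      ring
    rw [h6, add_add_add_comm, ← mul_add,
      ENNReal.add_le_add_iff_left (by finiteness)] at h5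
    rwa [← ENNReal.ofReal_mul (by positivity)]
  have hI := setLIntegral_mono' (μ := volume) measurableSet_Ioo hpt
  have hAm : Measurable A := measurable_lintegral_Ioo (hA a (b - a) (c - a))
  rw [lintegral_const_mul' _ _ ENNReal.ofReal_ne_top, lintegral_Ioo_one_sub_two_mul,
    lintegral_const_mul' _ _ ENNReal.ofReal_ne_top, lintegral_add_left hAm] at hI
  have hfin := mul_le_mul_left hI (ENNReal.ofReal J)
  rw [mul_assoc, mul_assoc, add_mul, mul_comm (∫⁻ u in _, A u), mul_comm (∫⁻ u in _, B u)] at hfin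
  have hfin2 := hfin.trans (mul_le_mul_right (add_le_add hAS hBS) _)
  rw [← ENNReal.ofReal_add (by positivity) (by positivity), ← ENNReal.ofReal_mul (by positivity),
    ← ENNReal.ofReal_mul (by positivity), ← ENNReal.ofReal_mul (by positivity),
    ENNReal.ofReal_le_ofReal_iff (by positivity)] at hfin2
  have h7 : δ ^ 2 = (v b - v a) ^ 2 := sq_abs _
  rw [← h7]
  have h8 := mul_le_mul_of_nonneg_left hfin2 (show 0 ≤ 8 * δ by positivity)
  have h9 : 8 * δ * (h ^ 2 / δ * (S ^ 2 + S ^ 2)) = 16 * h ^ 2 * S ^ 2 := by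
    have hδ0 : δ ≠ 0 := hpos.ne'
    field_simp
    ring
  rw [h9] at h8
  linarith

end VEM

namespace VEM

/-! ### Sets that are star-shaped with respect to a ball -/

section StarShaped

variable {D : Set Plane} {c : Plane} {r : ℝ}

/-- Approximate `w` by `w'` in `D` and compensate by moving `y` to `y + (t / (1 - t)) (w - w')`,
which is still in the ball; the point on the segment is unchanged. -/
theorem lineMap_mem_of_mem_closure (hs : ∀ y ∈ Metric.ball c r, StarConvex ℝ y D)
    {y w : Plane} (hy : y ∈ Metric.ball c r) (hw : w ∈ closure D) {t : ℝ} (h0 : 0 ≤ t)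
    (h1 : t < 1) : y + t • (w - y) ∈ D := by
  have ht : 0 < 1 - t := sub_pos.mpr h1
  have hcont : Continuous fun w' : Plane => y + (t / (1 - t)) • (w - w') := by fun_prop
  have hnear : ∀ᶠ w' in 𝓝 w, y + (t / (1 - t)) • (w - w') ∈ Metric.ball c r := by
    refine hcont.continuousAt.eventually (Metric.isOpen_ball.mem_nhds ?_)
    simpa using hy
  obtain ⟨w', hw', hwD⟩ := mem_closure_iff_nhds.mp hw _ hnear
  have := hs _ hw' hwD ht.le h0 (by ring)
  convert this using 1
  rw [smul_add, smul_smul, mul_div_cancel₀ _ ht.ne']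
  module

theorem triangle_subset (hr : 0 < r) (hs : ∀ y ∈ Metric.ball c r, StarConvex ℝ y D)
    {a b : Plane} (hab : ∀ t : ℝ, 0 ≤ t → t ≤ 1 → a + t • (b - a) ∈ closure D)
    (u s : ℝ) (hu : 0 < u) (hs0 : 0 < s) (hus : u + s < 1) :
    a + u • (b - a) + s • (c - a) ∈ D := by
  have h1 : 0 < 1 - s := by linarith
  have := lineMap_mem_of_mem_closure hs (Metric.mem_ball_self hr)
    (hab (u / (1 - s)) (by positivity) ((div_le_one h1).mpr (by linarith))) h1.le
    (by linarith : 1 - s < 1)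
  convert this using 1
  rw [add_sub_right_comm, smul_add (1 - s), smul_smul, mul_div_cancel₀ _ h1.ne']
  module

/-- The cross product is the edge length times the distance from `c` to the line of the edge. If
that distance were below `r`, the foot of the perpendicular would lie in the ball. Either the foot
is on the edge, or an endpoint lies strictly between it and the other endpoint; both cases put a
point of the edge in `D`. -/
theorem mul_norm_le_abs_cross (hb : Metric.ball c r ⊆ D)
    (hs : ∀ y ∈ Metric.ball c r, StarConvex ℝ y D) (hr : 0 < r) {a b : Plane} (hne : a ≠ b)
    (hab : ∀ t : ℝ, 0 ≤ t → t ≤ 1 → a + t • (b - a) ∈ closure D ∧ a + t • (b - a) ∉ D) :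
    r * ‖b - a‖ ≤ |cross (b - a) (c - a)| := by
  by_contra! hlt
  have hL : 0 < ‖b - a‖ := norm_pos_iff.mpr (sub_ne_zero.mpr hne.symm)
  have ha := hab 0 le_rfl zero_le_one
  have hb1 := hab 1 zero_le_one le_rfl
  simp only [zero_smul, add_zero, one_smul, add_sub_cancel] at ha hb1
  set L := ‖b - a‖ with hLdef
  -- The parameter of the foot of the perpendicular from `c`.
  set t : ℝ := inner ℝ (b - a) (c - a) / L ^ 2 with htdef
  have hL2 : L ^ 2 = (b - a) 0 ^ 2 + (b - a) 1 ^ 2 := by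
    rw [hLdef, EuclideanSpace.real_norm_sq_eq, Fin.sum_univ_two]
  have hinner : t * L ^ 2 = (b - a) 0 * (c - a) 0 + (b - a) 1 * (c - a) 1 := by
    rw [htdef, div_mul_cancel₀ _ (by positivity), PiLp.inner_apply, Fin.sum_univ_two]
    simp [mul_comm]
  have hdist : ‖a + t • (b - a) - c‖ ^ 2 * L ^ 2 = cross (b - a) (c - a) ^ 2 := by
    have h1 : ‖a + t • (b - a) - c‖ ^ 2 =
        (t * (b - a) 0 - (c - a) 0) ^ 2 + (t * (b - a) 1 - (c - a) 1) ^ 2 := by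
      rw [EuclideanSpace.real_norm_sq_eq, Fin.sum_univ_two]
      simp
      ring
    rw [h1, cross]
    generalize (b - a) 0 = p at *
    generalize (b - a) 1 = q at *
    generalize (c - a) 0 = p' at *
    generalize (c - a) 1 = q' at *
    rw [hL2] at hinner ⊢
    linear_combination (t * (p ^ 2 + q ^ 2) - (p * p' + q * q')) * hinner
  have hy : a + t • (b - a) ∈ Metric.ball c r := by
    rw [mem_ball_iff_norm]
    refine lt_of_pow_lt_pow_left₀ 2 hr.le ?_
    refine lt_of_mul_lt_mul_right ?_ (sq_nonneg L)
    rw [hdist, ← mul_pow, sq_lt_sq, abs_of_pos (mul_pos hr hL)]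
    exact hlt
  rcases lt_or_ge t 0 with h0 | h0
  · refine ha.2 ?_
    have := lineMap_mem_of_mem_closure hs hy hb1.1 (t := -t / (1 - t))
      (div_nonneg (by linarith) (by linarith)) ((div_lt_one (by linarith)).mpr (by linarith))
    convert this using 1
    have h2 : b - (a + t • (b - a)) = (1 - t) • (b - a) := by module
    rw [h2, smul_smul, div_mul_cancel₀ _ (by linarith : 1 - t ≠ 0)]
    module
  rcases le_or_gt t 1 with h1 | h1
  · exact (hab t h0 h1).2 (hb hy)
  · refine hb1.2 ?_
    have := lineMap_mem_of_mem_closure hs hy ha.1 (t := (t - 1) / t)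
      (div_nonneg (by linarith) (by linarith)) ((div_lt_one (by linarith)).mpr (by linarith))
    convert this using 1
    have h2 : a - (a + t • (b - a)) = t • (a - b) := by module
    rw [h2, smul_smul, div_mul_cancel₀ _ (by linarith : t ≠ 0)]
    module

end StarShaped

/-! ### Geometry of an element and of the triangles over its edges -/

namespace PolygonalElement

variable (P : PolygonalElement)

theorem mem_edge_iff {i : Fin P.n} {y : Plane} : y ∈ P.edge i ↔
    ∃ t : ℝ, 0 ≤ t ∧ t ≤ 1 ∧
      y = P.vertex i + t • (P.vertex (finRotate P.n i) - P.vertex i) := by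
  constructor
  · rintro ⟨t, ht, rfl⟩
    refine ⟨t, ht.1, ht.2, ?_⟩
    rw [AffineMap.lineMap_apply_module']
    exact add_comm _ _
  · rintro ⟨t, h0, h1, rfl⟩
    refine ⟨t, ⟨h0, h1⟩, ?_⟩
    rw [AffineMap.lineMap_apply_module']
    exact add_comm _ _

theorem add_smul_mem_edge (i : Fin P.n) {t : ℝ} (h0 : 0 ≤ t) (h1 : t ≤ 1) :
    P.vertex i + t • (P.vertex (finRotate P.n i) - P.vertex i) ∈ P.edge i :=
  P.mem_edge_iff.mpr ⟨t, h0, h1, rfl⟩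

theorem edge_subset_frontier (i : Fin P.n) : P.edge i ⊆ frontier P.carrier := by
  rw [P.frontier_eq]
  exact Set.subset_iUnion (fun i => P.poly.edgeSet ℝ i) i

theorem notMem_of_mem_edge {i : Fin P.n} {y : Plane} (hy : y ∈ P.edge i) : y ∉ P.carrier := by
  have := (P.edge_subset_frontier i hy).2
  rwa [P.isOpen.interior_eq] at this

theorem mem_closure_of_mem_edge {i : Fin P.n} {y : Plane} (hy : y ∈ P.edge i) :
    y ∈ closure P.carrier :=
  (P.edge_subset_frontier i hy).1

theorem vertex_mem_edge (i : Fin P.n) : P.vertex i ∈ P.edge i :=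
  P.mem_edge_iff.mpr ⟨0, le_rfl, zero_le_one, by simp⟩

theorem vertex_next_mem_edge (i : Fin P.n) : P.vertex (finRotate P.n i) ∈ P.edge i :=
  P.mem_edge_iff.mpr ⟨1, zero_le_one, le_rfl, by simp⟩

theorem dist_le_diam {x y : Plane} (hx : x ∈ closure P.carrier) (hy : y ∈ closure P.carrier) :
    dist x y ≤ P.diam := by
  rw [diam, ← Metric.diam_closure]
  exact Metric.dist_le_diam_of_mem P.isBounded.closure hx hy

theorem diam_pos : 0 < P.diam := by
  have h3 := P.three_le
  have hne : P.vertex ⟨0, by omega⟩ ≠ P.vertex ⟨1, by omega⟩ := fun h => by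
    simpa using P.injective h
  exact (dist_pos.mpr hne).trans_le (P.dist_le_diam
    (P.mem_closure_of_mem_edge (P.vertex_mem_edge _))
    (P.mem_closure_of_mem_edge (P.vertex_mem_edge _)))

theorem area_le : P.area ≤ Real.pi * P.diam ^ 2 := by
  obtain ⟨x, hx⟩ := P.isConnected.nonempty
  have hsub : P.carrier ⊆ Metric.closedBall x P.diam := fun y hy =>
    P.dist_le_diam (subset_closure hy) (subset_closure hx)
  have h := measureReal_mono (μ := volume) hsub measure_closedBall_lt_top.ne
  refine h.trans_eq ?_
  rw [measureReal_def, EuclideanSpace.volume_closedBall_fin_two]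
  simp [ENNReal.toReal_ofReal P.diam_pos.le, ENNReal.toReal_ofReal Real.pi_pos.le, mul_comm]

variable {P}

/-- The triangle spanned by `c` and the first half of the `i`-th edge. -/
def edgeTriangle (P : PolygonalElement) (c : Plane) (i : Fin P.n) : Set Plane :=
  halfTriangle (P.vertex i) (P.vertex (finRotate P.n i) - P.vertex i) (c - P.vertex i)

section Star

variable {c : Plane} {r : ℝ}

theorem edgeTriangle_subset (hr : 0 < r)
    (hs : ∀ y ∈ Metric.ball c r, StarConvex ℝ y P.carrier) (i : Fin P.n) :
    P.edgeTriangle c i ⊆ P.carrier := by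
  rintro _ ⟨p, ⟨h1, h2, h3, h4⟩, rfl⟩
  exact triangle_subset hr hs (fun t h0 h1 => P.mem_closure_of_mem_edge
    (P.add_smul_mem_edge i h0 h1)) _ _ h1 h3 (by linarith)

theorem exists_of_mem_edgeTriangle {i : Fin P.n} {p : Plane} (hp : p ∈ P.edgeTriangle c i) :
    ∃ τ t : ℝ, 0 < τ ∧ τ < 1 ∧ 0 < t ∧ t < 1 ∧ p = c +
      τ • (P.vertex i + t • (P.vertex (finRotate P.n i) - P.vertex i) - c) := by
  obtain ⟨q, ⟨h1, h2, h3, h4⟩, rfl⟩ := hp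
  have h5 : 0 < 1 - q.2 := by linarith
  refine ⟨1 - q.2, q.1 / (1 - q.2), h5, by linarith, by positivity,
    (div_lt_one h5).mpr (by linarith), ?_⟩
  rw [add_sub_right_comm, smul_add (1 - q.2), smul_smul, mul_div_cancel₀ _ h5.ne']
  module

/-- A ray from `c` meets the boundary only once: a point strictly between `c` and a boundary point
lies in the open set `P`. -/
theorem le_of_ray (hr : 0 < r) (hs : ∀ y ∈ Metric.ball c r, StarConvex ℝ y P.carrier)
    {i j : Fin P.n} {w w' : Plane} (hw : w ∈ P.edge i) (hw' : w' ∈ P.edge j) {τ τ' : ℝ}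
    (h0 : 0 < τ) (h0' : 0 < τ') (h : c + τ • (w - c) = c + τ' • (w' - c)) : τ' ≤ τ := by
  by_contra! hlt
  refine P.notMem_of_mem_edge hw' ?_
  have := lineMap_mem_of_mem_closure hs (Metric.mem_ball_self hr)
    (P.mem_closure_of_mem_edge hw) (t := τ / τ') (by positivity) ((div_lt_one h0').mpr hlt)
  convert this using 1
  have h2 := add_left_cancel h
  rw [div_eq_inv_mul, ← smul_smul, h2, smul_smul, inv_mul_cancel₀ h0'.ne']
  module

/-- Projecting a common point from `c` to the boundary gives one point interior to both edges, while
distinct edges share at most an endpoint. -/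
theorem disjoint_edgeTriangle (hr : 0 < r)
    (hs : ∀ y ∈ Metric.ball c r, StarConvex ℝ y P.carrier)
    (hne : ∀ i, P.vertex i ≠ P.vertex (finRotate P.n i)) {i j : Fin P.n} (hij : i ≠ j) :
    Disjoint (P.edgeTriangle c i) (P.edgeTriangle c j) := by
  rw [Set.disjoint_left]
  intro p hpi hpj
  obtain ⟨τ, t, hτ0, -, ht0, ht1, hp⟩ := exists_of_mem_edgeTriangle hpi
  obtain ⟨τ', t', hτ0', -, ht0', ht1', hp'⟩ := exists_of_mem_edgeTriangle hpj
  have hw := P.add_smul_mem_edge i ht0.le ht1.le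
  have hw' := P.add_smul_mem_edge j ht0'.le ht1'.le
  have hττ : τ = τ' := le_antisymm (le_of_ray hr hs hw' hw hτ0' hτ0 (hp'.symm.trans hp))
    (le_of_ray hr hs hw hw' hτ0 hτ0' (hp.symm.trans hp'))
  have hww : P.vertex i + t • (P.vertex (finRotate P.n i) - P.vertex i) =
      P.vertex j + t' • (P.vertex (finRotate P.n j) - P.vertex j) := by
    have h := add_left_cancel (hp.symm.trans hp')
    rw [hττ] at h
    exact sub_left_injective (smul_right_injective _ hτ0'.ne' h)
  -- Adjacent edges could meet only at the far end of the earlier one, which is parameter `1`.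
  have hnext : ∀ (k : Fin P.n) (s : ℝ), s < 1 →
      P.vertex k + s • (P.vertex (finRotate P.n k) - P.vertex k) ≠
        P.vertex (finRotate P.n k) := by
    intro k s hs1 h
    have h2 : (1 - s) • (P.vertex (finRotate P.n k) - P.vertex k) = 0 := by
      rw [sub_smul, one_smul, sub_eq_zero, sub_eq_iff_eq_add']
      exact h.symm
    rcases smul_eq_zero.mp h2 with h3 | h3
    · linarith
    · exact hne k (sub_eq_zero.mp h3).symm
  by_cases h1 : j = finRotate P.n i
  · have := P.edge_inter_next i
    rw [← h1] at this
    have hmem := this.subset ⟨hw, hww ▸ hw'⟩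
    exact hnext i t ht1 ((Set.mem_singleton_iff.mp hmem).trans (congrArg P.vertex h1))
  by_cases h2 : i = finRotate P.n j
  · have := P.edge_inter_next j
    rw [← h2] at this
    have hmem := this.subset ⟨hw', hww ▸ hw⟩
    exact hnext j t' ht1' ((Set.mem_singleton_iff.mp hmem).trans (congrArg P.vertex h2))
  · exact Set.disjoint_left.mp (P.edge_disjoint i j hij h1 h2) hw (hww ▸ hw')

end Star

/-! ### Regular elements -/

section Regular

variable {ρ : ℝ}

theorem IsRegular.vertex_ne (hP : P.IsRegular ρ) (hρ : 0 < ρ) (i : Fin P.n) :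
    P.vertex i ≠ P.vertex (finRotate P.n i) :=
  dist_pos.mp ((mul_pos hρ P.diam_pos).trans_le (hP.2 i))

/-- The ball bounds the height of each triangle from below, and the minimal edge length bounds its
base. -/
theorem IsRegular.exists_center (hP : P.IsRegular ρ) (hρ : 0 < ρ) :
    ∃ (c : Plane) (r : ℝ), 0 < r ∧ c ∈ P.carrier ∧
      (∀ y ∈ Metric.ball c r, StarConvex ℝ y P.carrier) ∧
      ∀ i, (ρ * P.diam) ^ 2 ≤
        |cross (P.vertex (finRotate P.n i) - P.vertex i) (c - P.vertex i)| := by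
  obtain ⟨⟨c, r, hr, hb, hs⟩, hE⟩ := id hP
  have hh := mul_pos hρ P.diam_pos
  have hr0 : 0 < r := hh.trans hr
  refine ⟨c, r, hr0, hb (Metric.mem_ball_self hr0), hs, fun i => ?_⟩
  have h1 := mul_norm_le_abs_cross hb hs hr0 (hP.vertex_ne hρ i) fun t h0 h1 =>
    ⟨P.mem_closure_of_mem_edge (P.add_smul_mem_edge i h0 h1), P.notMem_of_mem_edge (P.add_smul_mem_edge i h0 h1)⟩
  have h2 := hE i
  rw [edgeLength, dist_comm, dist_eq_norm] at h2
  refine le_trans ?_ h1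
  rw [sq]
  exact mul_le_mul hr.le h2 hh.le hr0.le

/-- The half triangles are disjoint in `P` and each has area at least `(ρ h_P)² / 4`, while the area
of `P` is at most `π h_P²`. -/
theorem IsRegular.card_le (hP : P.IsRegular ρ) (hρ : 0 < ρ) :
    (P.n : ℝ) ≤ 4 * Real.pi / ρ ^ 2 := by
  obtain ⟨c, r, hr, hc, hs, hJ⟩ := hP.exists_center hρ
  have hh := mul_pos hρ P.diam_pos
  have hne : ∀ i, cross (P.vertex (finRotate P.n i) - P.vertex i) (c - P.vertex i) ≠ 0 :=
    fun i => abs_pos.mp ((pow_pos hh 2).trans_le (hJ i))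
  have hvol : ∀ i, (ρ * P.diam) ^ 2 / 4 ≤ volume.real (P.edgeTriangle c i) := by
    intro i
    rw [measureReal_def, edgeTriangle, volume_halfTriangle _ (hne i),
      ENNReal.toReal_ofReal (by positivity)]
    linarith [hJ i]
  have hsum : ∑ i, volume.real (P.edgeTriangle c i) ≤ P.area := by
    rw [← measureReal_biUnion_finset
      (fun i _ j _ hij => disjoint_edgeTriangle hr hs (hP.vertex_ne hρ) hij)
      (fun i _ => (isOpen_halfTriangle _ (hne i)).measurableSet)
      (fun i _ => by rw [edgeTriangle, volume_halfTriangle _ (hne i)]; exact ENNReal.ofReal_ne_top)]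
    exact measureReal_mono (Set.iUnion₂_subset fun i _ => edgeTriangle_subset hr hs i)
      P.isBounded.measure_lt_top.ne
  have h1 : (P.n : ℝ) * ((ρ * P.diam) ^ 2 / 4) ≤ Real.pi * P.diam ^ 2 := by
    refine le_trans ?_ (hsum.trans P.area_le)
    have := Finset.sum_le_sum fun (i : Fin P.n) (_ : i ∈ Finset.univ) => hvol i
    simpa using this
  rw [le_div_iff₀ (by positivity)]
  have hd := pow_pos P.diam_pos 2
  refine le_of_mul_le_mul_right ?_ hd
  rw [mul_pow] at h1
  linarith

end Regular

end PolygonalElement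

end VEM

namespace VEM

namespace PolygonalElement

/-! ### The projection error -/

/-- Telescoping from index `0`, with the value there as the constant; the closing edge of the cycle
is not needed. -/
theorem exists_abs_sub_le_of_finRotate : ∀ {n : ℕ} (f : Fin n → ℝ) {K : ℝ},
    (∀ i, |f (finRotate n i) - f i| ≤ K) → ∃ k, ∀ i, |f i - k| ≤ n * K
  | 0, _, _, _ => ⟨0, fun i => i.elim0⟩
  | m + 1, f, K, h => by
    have hK : 0 ≤ K := (abs_nonneg _).trans (h 0)
    have key : ∀ (k : ℕ) (hk : k < m + 1), |f ⟨k, hk⟩ - f 0| ≤ k * K := by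
      intro k
      induction k with
      | zero => intro _; simp
      | succ k ih =>
        intro hk
        have h1 := h ⟨k, by omega⟩
        rw [finRotate_of_lt (by omega : k < m)] at h1
        have h2 := abs_sub_le (f ⟨k + 1, hk⟩) (f ⟨k, by omega⟩) (f 0)
        have h3 := ih (by omega)
        push_cast
        linarith
    refine ⟨f 0, fun i => (key i i.2).trans ?_⟩
    exact mul_le_mul_of_nonneg_right (by exact_mod_cast i.2.le) hK

variable {P : PolygonalElement} {ρ : ℝ} {v : Plane → ℝ}

theorem MemVEM.contDiffOn (hv : P.MemVEM v) : ContDiffOn ℝ 1 v P.carrier :=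
  hv.2.2.2.contDiffOn.of_le (by norm_num)

theorem MemVEM.abs_vertex_sub_le (hv : P.MemVEM v) (hP : P.IsRegular ρ) (hρ : 0 < ρ)
    (i : Fin P.n) : |v (P.vertex (finRotate P.n i)) - v (P.vertex i)| ≤
      4 / ρ * h1Seminorm P.carrier v := by
  obtain ⟨c, r, hr, hc, hs, hJ⟩ := hP.exists_center hρ
  have hh := mul_pos hρ P.diam_pos
  have hS : 0 ≤ h1Seminorm P.carrier v := Real.sqrt_nonneg _
  obtain ⟨q, hq⟩ := hv.2.2.1 i
  have hcd : ∀ y ∈ closure P.carrier, ‖c - y‖ ≤ P.diam := fun y hy => by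
    rw [← dist_eq_norm]
    exact P.dist_le_diam (subset_closure hc) hy
  have h := sq_sub_mul_cross_le P.isOpen hv.contDiffOn hv.2.1
    (hcd _ (P.mem_closure_of_mem_edge (P.vertex_mem_edge i)))
    (hcd _ (P.mem_closure_of_mem_edge (P.vertex_next_mem_edge i)))
    (abs_pos.mp ((pow_pos hh 2).trans_le (hJ i)))
    (triangle_subset hr hs fun t h0 h1 => P.mem_closure_of_mem_edge (P.add_smul_mem_edge i h0 h1))
    ⟨q, fun u h0 h1 => hq (P.add_smul_mem_edge i h0 h1)⟩
    (lintegral_fderiv_sq_le P.isOpen hv.1 hv.contDiffOn)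
  have h1 := (mul_le_mul_of_nonneg_left (hJ i) (sq_nonneg _)).trans h
  refine abs_le_of_sq_le_sq ?_ (by positivity)
  rw [mul_pow, div_pow, div_mul_eq_mul_div, le_div_iff₀ (by positivity)]
  -- The diameter cancels: in the plane the Dirichlet seminorm is scale invariant.
  refine le_of_mul_le_mul_right ?_ (pow_pos P.diam_pos 2)
  rw [mul_pow] at h1
  linarith

/-- Pythagoras: the residual is orthogonal to `piLS v - k`, which is affine, so the cross term
vanishes. -/
theorem sum_sq_sub_piLS_le (P : PolygonalElement) (v : Plane → ℝ) (k : ℝ) :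
    ∑ i, (v (P.vertex i) - P.piLS v (P.vertex i)) ^ 2 ≤ ∑ i, (v (P.vertex i) - k) ^ 2 := by
  have h := P.isPiLS_piLS v (P.piLS v - AffineMap.const ℝ Plane k)
  rw [discreteInner, mul_eq_zero, or_iff_right P.area_pos.ne'] at h
  have h2 : ∑ i, (v (P.vertex i) - k) ^ 2 =
      ∑ i, (v (P.vertex i) - P.piLS v (P.vertex i)) ^ 2 +
        2 * ∑ i, (v (P.vertex i) - P.piLS v (P.vertex i)) *
          (P.piLS v - AffineMap.const ℝ Plane k) (P.vertex i) +
        ∑ i, (P.piLS v (P.vertex i) - k) ^ 2 := by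
    rw [Finset.mul_sum, ← Finset.sum_add_distrib, ← Finset.sum_add_distrib]
    refine Finset.sum_congr rfl fun i _ => ?_
    simp
    ring
  rw [h2, h]
  have := Finset.sum_nonneg fun (i : Fin P.n) (_ : i ∈ Finset.univ) =>
    sq_nonneg (P.piLS v (P.vertex i) - k)
  linarith

theorem MemVEM.abs_vertex_sub_piLS_le (hv : P.MemVEM v) (hP : P.IsRegular ρ) (hρ : 0 < ρ)
    (i : Fin P.n) : |v (P.vertex i) - P.piLS v (P.vertex i)| ≤
      (P.n : ℝ) ^ 2 * (4 / ρ * h1Seminorm P.carrier v) := by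
  have hS : 0 ≤ h1Seminorm P.carrier v := Real.sqrt_nonneg _
  set K := 4 / ρ * h1Seminorm P.carrier v with hK
  have hK0 : 0 ≤ K := by positivity
  obtain ⟨k, hk⟩ := exists_abs_sub_le_of_finRotate (fun i => v (P.vertex i))
    (fun i => hv.abs_vertex_sub_le hP hρ i)
  have hn : (1 : ℝ) ≤ P.n := by exact_mod_cast (by linarith [P.three_le] : 1 ≤ P.n)
  refine abs_le_of_sq_le_sq ?_ (by positivity)
  calc (v (P.vertex i) - P.piLS v (P.vertex i)) ^ 2
      ≤ ∑ i, (v (P.vertex i) - P.piLS v (P.vertex i)) ^ 2 :=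
        Finset.single_le_sum (f := fun i => (v (P.vertex i) - P.piLS v (P.vertex i)) ^ 2)
          (fun _ _ => sq_nonneg _) (Finset.mem_univ i)
    _ ≤ ∑ i, (v (P.vertex i) - k) ^ 2 := P.sum_sq_sub_piLS_le v k
    _ ≤ ∑ _i : Fin P.n, ((P.n : ℝ) * K) ^ 2 :=
        Finset.sum_le_sum fun i _ => sq_le_sq' (abs_le.mp (hk i)).1 (abs_le.mp (hk i)).2
    _ = (P.n : ℝ) * (P.n : ℝ) ^ 2 * K ^ 2 := by simp; ring
    -- The factor `n³` is rounded up to `n⁴` to obtain a perfect square.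
    _ ≤ ((P.n : ℝ) ^ 2 * K) ^ 2 := by
        rw [mul_pow _ K]
        refine mul_le_mul_of_nonneg_right ?_ (sq_nonneg K)
        nlinarith [pow_pos (zero_lt_one.trans_le hn) 3]

theorem abs_le_on_edge {f : Plane → ℝ} {i : Fin P.n}
    (hf : ∃ q : Plane →ᵃ[ℝ] ℝ, Set.EqOn f q (P.edge i)) {M : ℝ}
    (hM : ∀ i, |f (P.vertex i)| ≤ M) {y : Plane} (hy : y ∈ P.edge i) : |f y| ≤ M := by
  obtain ⟨q, hq⟩ := hf
  have h0 := hM i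
  have h1 := hM (finRotate P.n i)
  rw [hq (P.vertex_mem_edge i)] at h0
  rw [hq (P.vertex_next_mem_edge i)] at h1
  rw [hq hy]
  obtain ⟨t, ht, rfl⟩ := hy
  have := (convex_Icc (-M) M) (abs_le.mp h0) (abs_le.mp h1) (sub_nonneg.mpr ht.2) ht.1 (by ring)
  rw [AffineMap.apply_lineMap, AffineMap.lineMap_apply_module]
  exact abs_le.mpr this

theorem MemVEM.abs_sub_piLS_le (hv : P.MemVEM v) (hP : P.IsRegular ρ) (hρ : 0 < ρ) :
    ∀ x ∈ P.carrier, |v x - P.piLS v x| ≤ (P.n : ℝ) ^ 2 * (4 / ρ * h1Seminorm P.carrier v) := by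
  have hq : Continuous (P.piLS v) := (P.piLS v).continuous_of_finiteDimensional
  refine abs_le_of_harmonicOnNhd_of_abs_le_frontier (f := fun x => v x - P.piLS v x) P.isOpen
    P.isBounded (hv.2.2.2.sub (harmonicOnNhd_affineMap _ _)) (hv.2.1.sub hq.continuousOn) ?_
  intro x hx
  rw [P.frontier_eq, Polygon.boundary, Set.mem_iUnion] at hx
  obtain ⟨i, hi⟩ := hx
  obtain ⟨q, hqE⟩ := hv.2.2.1 i
  refine abs_le_on_edge (f := fun x => v x - P.piLS v x)
    ⟨q - P.piLS v, fun y hy => ?_⟩ (fun j => hv.abs_vertex_sub_piLS_le hP hρ j) hi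
  simp [hqE hy]

theorem MemVEM.l2Norm_sub_piLS_le (hv : P.MemVEM v) (hP : P.IsRegular ρ) (hρ : 0 < ρ) :
    l2Norm P.carrier (fun x => v x - P.piLS v x) ≤
      8 / ρ * (4 * Real.pi / ρ ^ 2) ^ 2 * P.diam * h1Seminorm P.carrier v := by
  have hS : 0 ≤ h1Seminorm P.carrier v := Real.sqrt_nonneg _
  have hh := P.diam_pos
  set M := (P.n : ℝ) ^ 2 * (4 / ρ * h1Seminorm P.carrier v) with hM
  have hM0 : 0 ≤ M := by positivity
  have hI : ∫ x in P.carrier, ‖v x - P.piLS v x‖ ^ 2 ≤ M ^ 2 * P.area := by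
    refine (Real.le_norm_self _).trans (norm_setIntegral_le_of_norm_le_const
      P.isBounded.measure_lt_top fun x hx => ?_)
    rw [norm_pow, norm_norm]
    exact pow_le_pow_left₀ (norm_nonneg _) (hv.abs_sub_piLS_le hP hρ x hx) 2
  -- The factor `2` comes from `π ≤ 4`, which gives area at most `(2 h_P)²`.
  have hle : l2Norm P.carrier (fun x => v x - P.piLS v x) ≤ M * (2 * P.diam) := by
    refine Real.sqrt_le_iff.mpr ⟨by positivity, hI.trans ?_⟩
    rw [mul_pow M]
    refine mul_le_mul_of_nonneg_left (P.area_le.trans ?_) (sq_nonneg M)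
    nlinarith [Real.pi_le_four, pow_pos hh 2]
  have hn : (P.n : ℝ) ^ 2 ≤ (4 * Real.pi / ρ ^ 2) ^ 2 :=
    pow_le_pow_left₀ (Nat.cast_nonneg _) (hP.card_le hρ) 2
  calc l2Norm P.carrier (fun x => v x - P.piLS v x) ≤ M * (2 * P.diam) := hle
    _ = (P.n : ℝ) ^ 2 * (8 / ρ * P.diam * h1Seminorm P.carrier v) := by rw [hM]; ring
    _ ≤ (4 * Real.pi / ρ ^ 2) ^ 2 * (8 / ρ * P.diam * h1Seminorm P.carrier v) :=
        mul_le_mul_of_nonneg_right hn (by positivity)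
    _ = _ := by ring

end PolygonalElement

end VEM

theorem mainTheorem6 (ρ : ℝ) (hρ : 0 < ρ) :
    ∃ C : ℝ, 0 < C ∧
      (∀ P : VEM.PolygonalElement, P.IsRegular ρ → ∀ v : Plane → ℝ, P.MemVEM v →
        VEM.l2Norm P.carrier (fun x => v x - P.piLS v x) ≤
          C * P.diam * VEM.h1Seminorm P.carrier v) ∧
      (∀ Ω : Set Plane, VEM.IsPolygonalDomain Ω → ∀ T : VEM.Mesh Ω, T.IsRegular ρ →
        ∀ v : Plane → ℝ, T.MemVEM v → ∀ P ∈ T.elements,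
          VEM.l2Norm P.carrier (fun x => v x - P.piLS v x) ≤
            C * P.diam * VEM.h1Seminorm P.carrier v) := by
  have hpi := Real.pi_pos
  refine ⟨8 / ρ * (4 * Real.pi / ρ ^ 2) ^ 2, by positivity,
    fun P hP v hv => hv.l2Norm_sub_piLS_le hP hρ,
    fun Ω _ T hT v hv P hPT => (hv.2 P hPT).l2Norm_sub_piLS_le (hT P hPT) hρ⟩
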